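/- Let $g\ge 2$ and let $\mathcal H_g$ be the Siegel upper half-space of complex symmetric $g\times g$ matrices with positive definite imaginary part. For $\varepsilon,\delta\in\mathbb F_2^g$ (lifted to $\{0,1\}^g$), $\tau\in\mathcal H_g$ and $z\in\mathbb C^g$ let $$\theta_{[\varepsilon,\delta]}(\tau,z)=\sum_{p\in\mathbb Z^g}\exp\Big(\pi i\big[(p+\tfrac{\varepsilon}{2})^t\tau(p+\tfrac{\varepsilon}{2})+2(p+\tfrac{\varepsilon}{2})^t(z+\tfrac{\delta}{2})\big]\Big),\qquad \Theta[\sigma](\tau,z)=\theta_{[\sigma,0]}(2\tau,2z).$$ The characteristic $[\varepsilon,\delta]$ is called odd if $\varepsilon\cdot\delta=1\in\mathbb F_2$, and $v_m(\tau)=\operatorname{grad}_z\theta_m(\tau,z)|_{z=0}\in\mathbb C^g$ for $m$ odd. For distinct odd characteristics $m_1,\dots,m_{g-1}$ let $F=(F_1,\dots,F_g)=v_{m_1}(\tau)\wedge\dots\wedge v_{m_{g-1}}(\tau)$, where $F_i$ is the determinant of the matrix with rows $v_{m_1}(\tau),\dots,v_{m_{g-1}}(\tau),e_i$ (so $v_{m_1}\wedge\dots\wedge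 v_{m_{g-1}}\wedge e_i=F_i\,e_1\wedge\dots\wedge e_g$), and let $$W(m_1,\dots,m_{g-1})(\tau)=\pi^{-2g+2}\,F^tF=\pi^{-2g+2}\,(F_iF_j)_{i,j},$$ which does not depend on the order of the $m_j$. For $\varepsilon,\delta\in\mathbb F_2^g$ let $A_{\varepsilon\delta}(\tau)$ be the symmetric $g\times g$ matrix with entries $$A_{\varepsilon\delta,ij}(\tau)=\big(\partial_{z_i}\partial_{z_j}\Theta[\delta]\big)(\tau,0)\,\Theta[\varepsilon](\tau,0)-\big(\partial_{z_i}\partial_{z_j}\Theta[\varepsilon]\big)(\tau,0)\,\Theta[\delta](\tau,0),$$ and let $A^{ad}_{\varepsilon\delta}$ be its adjugate, the transpose of the matrix of cofactors. Then for all $\varepsilon\ne\delta$ in $\mathbb F_2^g$ and all $\tau\in\mathcal H_g$ $$A^{ad}_{\varepsilon\delta}(\tau)=\Big(\frac{\pi^2}{2^{g-2}}\Big)^{g-1}\sum_{\{\alpha_1,\dots,\alpha_{g-1}\}}(-1)^{\delta\cdot(\alpha_1+\dots+\alpha_{g-1})}\,W\big([\varepsilon+\delta,\alpha_1],\dots,[\varepsilon+\delta,\alpha_{g-1}]\big)(\tau),$$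 where the sum runs over all sets of $g-1$ distinct elements $\alpha_1,\dots,\alpha_{g-1}\in\mathbb F_2^g$ such that every $[\varepsilon+\delta,\alpha_j]$ is odd (each unordered set is counted once). -/

import Mathlib

open scoped Matrix

noncomputable section

namespace ThetaGradients

/-- The Siegel upper half-space: complex symmetric `g × g` matrices with positive definite
imaginary part. -/
def siegelUpperHalfSpace (g : ℕ) : Set (Matrix (Fin g) (Fin g) ℂ) :=
  {τ | τ.IsSymm ∧ (τ.map Complex.im).PosDef}

/-- `𝔽₂^g`. -/
abbrev F2 (g : ℕ) : Type := Fin g → ZMod 2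

/-- A theta characteristic `[ε, δ]` with `ε, δ ∈ 𝔽₂^g`. -/
abbrev Characteristic (g : ℕ) : Type := F2 g × F2 g

/-- `[ε, δ]` is odd if `ε · δ = 1` in `𝔽₂`. -/
abbrev Characteristic.IsOdd {g : ℕ} (m : Characteristic g) : Prop := m.1 ⬝ᵥ m.2 = 1

/-- The vector `ε / 2 ∈ ℂ^g`, where `ε ∈ 𝔽₂^g` is lifted to `{0, 1}^g`. -/
def half {g : ℕ} (ε : F2 g) : Fin g → ℂ := fun i => ((ε i).val : ℂ) / 2

/-- The theta function with characteristic `m = [ε, δ]`: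
`∑_{p ∈ ℤ^g} exp (π i [(p + ε/2)ᵗ τ (p + ε/2) + 2 (p + ε/2)ᵗ (z + δ/2)])`. -/
def theta {g : ℕ} (m : Characteristic g) (τ : Matrix (Fin g) (Fin g) ℂ) (z : Fin g → ℂ) : ℂ :=
  ∑' p : Fin g → ℤ,
    let u : Fin g → ℂ := (fun i => (p i : ℂ)) + half m.1
    Complex.exp (Real.pi * Complex.I * (u ⬝ᵥ (τ *ᵥ u) + 2 * (u ⬝ᵥ (z + half m.2))))

/-- The second order theta function `Θ[σ](τ, z) = θ[σ, 0](2τ, 2z)`. -/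
def theta2 {g : ℕ} (σ : F2 g) (τ : Matrix (Fin g) (Fin g) ℂ) (z : Fin g → ℂ) : ℂ :=
  theta (σ, 0) ((2 : ℂ) • τ) ((2 : ℂ) • z)

/-- The partial derivative `∂f/∂z_i` of a function on `ℂ^g`. -/
def partialZ {g : ℕ} (i : Fin g) (f : (Fin g → ℂ) → ℂ) : (Fin g → ℂ) → ℂ :=
  fun z => lineDeriv ℂ f z (Pi.single i 1)

/-- The gradient `v_m(τ) = grad_z θ_m(τ, z)` at `z = 0`. -/
def thetaGrad {g : ℕ} (m : Characteristic g) (τ : Matrix (Fin g) (Fin g) ℂ) : Fin g → ℂ :=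
  fun i => partialZ i (theta m τ) 0

/-- The matrix `A_{εδ}(τ)` with entries
`(∂_{z_i} ∂_{z_j} Θ[δ]) Θ[ε] - (∂_{z_i} ∂_{z_j} Θ[ε]) Θ[δ]`, evaluated at `z = 0`. -/
def matA {g : ℕ} (ε δ : F2 g) (τ : Matrix (Fin g) (Fin g) ℂ) : Matrix (Fin g) (Fin g) ℂ :=
  Matrix.of fun i j =>
    partialZ i (partialZ j (theta2 δ τ)) 0 * theta2 ε τ 0
      - partialZ i (partialZ j (theta2 ε τ)) 0 * theta2 δ τ 0

/-- The wedge product `v_1 ∧ ⋯ ∧ v_{g-1}` of vectors of `ℂ^g`, as a vector of `ℂ^g` under the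
usual identification of `⋀^{g-1} ℂ^g` with (the dual of) `ℂ^g`: its `i`-th coordinate `F_i` is
given by `v_1 ∧ ⋯ ∧ v_{g-1} ∧ e_i = F_i • (e_1 ∧ ⋯ ∧ e_g)`, that is, `F_i` is the determinant
of the matrix with rows `v_1, …, v_{g-1}, e_i`. -/
def wedge {g : ℕ} (v : Fin (g - 1) → Fin g → ℂ) : Fin g → ℂ :=
  fun i => Matrix.det (Matrix.of fun r : Fin g =>
    if h : (r : ℕ) < g - 1 then v ⟨r, h⟩ else Pi.single i 1)

/-- `F(m_1, …, m_{g-1})(τ) = v_{m_1}(τ) ∧ ⋯ ∧ v_{m_{g-1}}(τ)`. -/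
def formF {g : ℕ} (m : Fin (g - 1) → Characteristic g) (τ : Matrix (Fin g) (Fin g) ℂ) :
    Fin g → ℂ :=
  wedge fun j => thetaGrad (m j) τ

/-- `W(m_1, …, m_{g-1})(τ) = π^{-2g+2} Fᵗ F`, where the row vector `F` is
`F(m_1, …, m_{g-1})(τ)`; its `(i, j)` entry is `π^{-2g+2} F_i F_j`. It does not depend on the
order of `m_1, …, m_{g-1}`. -/
def formW {g : ℕ} (m : Fin (g - 1) → Characteristic g) (τ : Matrix (Fin g) (Fin g) ℂ) :
    Matrix (Fin g) (Fin g) ℂ :=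
  (Real.pi : ℂ) ^ (-2 * (g : ℤ) + 2) • Matrix.vecMulVec (formF m τ) (formF m τ)

/-- The sign `(-1)^x` for `x ∈ 𝔽₂`. -/
def sign2 (x : ZMod 2) : ℂ := (-1) ^ x.val

end ThetaGradients

end

/-!
The addition formula expresses the square of a theta function through second order ones:
`θ[η, α](τ, x)² = ∑_ρ (-1)^(ρ·α) Θ[ρ](τ, x) Θ[ρ + η](τ, 0)`. An odd theta function vanishes at
`x = 0`, so applying `∂_i ∂_j` to its square gives `2 v_i v_j` there, where `v` is its gradient.
Fourier inversion on `𝔽₂^g`, with `η = ε + δ`, then isolates the two terms of `A_{εδ}` and writes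
this matrix as a signed sum of the rank one matrices `v_α v_αᵗ` over the `α` with `[ε + δ, α]` odd.
The Cauchy–Binet formula for its minors of size `g - 1` gives the adjugate.
-/

noncomputable section

namespace ThetaGradients

/-! ### The Cauchy–Binet formula -/

section CauchyBinet

variable {n : ℕ} {ι R : Type*}

theorem det_sum_vecMulVec [CommRing R] (s : Finset ι) (a b : ι → Fin n → R) :
    (∑ k ∈ s, Matrix.vecMulVec (a k) (b k)).det =
      ∑ f ∈ Fintype.piFinset fun _ => s,
        (∏ i, a (f i) i) * (Matrix.of fun i => b (f i)).det := by
  have hrows : ∑ k ∈ s, Matrix.vecMulVec (a k) (b k) = fun i => ∑ k ∈ s, a k i • b k := by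
    ext i j
    simp [Matrix.sum_apply, Matrix.vecMulVec_apply]
  rw [hrows]
  refine (MultilinearMap.map_sum_finset
    (Matrix.detRowAlternating (n := Fin n) (R := R)).toMultilinearMap
    (fun i k => a k i • b k) fun _ => s).trans (Finset.sum_congr rfl fun f _ => ?_)
  exact MultilinearMap.map_smul_univ _ (fun i => a (f i) i) fun i => b (f i)

variable [LinearOrder ι]

theorem sum_strictMono_sum_perm [AddCommMonoid R] (s : Finset ι) {F : (Fin n → ι) → R}
    (hF : ∀ f, ¬ Function.Injective f → F f = 0) :
    ∑ f ∈ Fintype.piFinset fun _ => s with StrictMono f, ∑ σ : Equiv.Perm (Fin n), F (f ∘ σ) =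
      ∑ f ∈ Fintype.piFinset fun _ => s, F f := by
  rw [← Finset.sum_product']
  refine Finset.sum_of_injOn (fun x => x.1 ∘ x.2) ?_ ?_ ?_ fun _ _ => rfl
  · rintro ⟨f, σ⟩ hf ⟨f', σ'⟩ hf' h
    simp only [Finset.coe_product, Finset.coe_filter, Finset.coe_univ, Set.mem_prod,
      Set.mem_ofPred_eq, Set.mem_univ, and_true] at hf hf' h
    have hrange : Set.range f = Set.range f' := by
      rw [← σ.surjective.range_comp f, ← σ'.surjective.range_comp f', h]
    obtain rfl : f = f' := (hf.2.range_inj hf'.2).mp hrange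
    rw [show σ = σ' from Equiv.ext fun i => hf.2.injective (congrFun h i)]
  · rintro ⟨f, σ⟩ hf
    simp only [Finset.coe_product, Finset.coe_filter, Finset.coe_univ, Set.mem_prod,
      Set.mem_ofPred_eq, Set.mem_univ, and_true, Fintype.mem_piFinset] at hf
    simp only [Finset.mem_coe, Fintype.mem_piFinset]
    exact fun i => hf.1 (σ i)
  · intro f hf hnot
    refine hF f fun hinj => hnot ⟨(f ∘ Tuple.sort f, (Tuple.sort f)⁻¹), ?_, ?_⟩
    · have hsort := (Tuple.monotone_sort f).strictMono_of_injective
        (hinj.comp (Equiv.injective _))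
      rw [Fintype.mem_piFinset] at hf
      simpa [hsort] using fun i => hf _
    · ext i
      simp

theorem cauchyBinet [CommRing R] (s : Finset ι) (a b : ι → Fin n → R) :
    (∑ k ∈ s, Matrix.vecMulVec (a k) (b k)).det =
      ∑ f ∈ Fintype.piFinset fun _ => s with StrictMono f,
        (Matrix.of fun i => a (f i)).det * (Matrix.of fun i => b (f i)).det := by
  rw [det_sum_vecMulVec, ← sum_strictMono_sum_perm]
  · refine Finset.sum_congr rfl fun f _ => ?_
    rw [Matrix.det_apply' (Matrix.of fun i => a (f i)), Finset.sum_mul]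
    refine Finset.sum_congr rfl fun σ _ => ?_
    have hperm := Matrix.det_permute σ (Matrix.of fun i => b (f i))
    calc (∏ i, a (f (σ i)) i) * ((Matrix.of fun i => b (f i)).submatrix σ id).det
        = (∏ i, a (f (σ i)) i) * (Equiv.Perm.sign σ * (Matrix.of fun i => b (f i)).det) := by
          rw [hperm]
      _ = _ := by
          simp only [Matrix.of_apply]
          ring
  · intro f hf
    obtain ⟨i, j, hij, hne⟩ := Function.not_injective_iff.1 hf
    rw [Matrix.det_zero_of_row_eq hne (by ext; simp [hij]), mul_zero]

end CauchyBinet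

/-! ### Wedge products and adjugates -/

section Wedge

variable {n : ℕ}

theorem wedge_eq_det_submatrix (v : Fin n → Fin (n + 1) → ℂ) (i : Fin (n + 1)) :
    wedge (g := n + 1) v i =
      (-1) ^ (n + (i : ℕ)) * ((Matrix.of v).submatrix id i.succAbove).det := by
  unfold wedge
  rw [Matrix.det_succ_row _ (Fin.last n), Finset.sum_eq_single i]
  · simp only [Fin.val_last, Matrix.of_apply, Nat.add_sub_cancel, lt_self_iff_false, dite_false,
      Pi.single_eq_same, mul_one]
    congr 2
    ext a b
    simp [Matrix.submatrix_apply]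
  · intro b _ hb
    simp [hb]
  · simp

theorem wedge_smul (d : Fin n → ℂ) (v : Fin n → Fin (n + 1) → ℂ) :
    wedge (g := n + 1) (fun j : Fin n => d j • v j) = (∏ j, d j) • wedge (g := n + 1) v := by
  ext i
  rw [Pi.smul_apply, smul_eq_mul, wedge_eq_det_submatrix, wedge_eq_det_submatrix, mul_left_comm,
    ← Matrix.det_mul_column]
  rfl

theorem adjugate_sum_vecMulVec {ι : Type*} [LinearOrder ι] (s : Finset ι)
    (a b : ι → Fin (n + 1) → ℂ) :
    (∑ k ∈ s, Matrix.vecMulVec (a k) (b k)).adjugate =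
      ∑ f ∈ Fintype.piFinset fun _ : Fin n => s with StrictMono f,
        Matrix.vecMulVec (wedge (g := n + 1) fun j : Fin n => b (f j))
          (wedge (g := n + 1) fun j : Fin n => a (f j)) := by
  ext i j
  have hminor : (∑ k ∈ s, Matrix.vecMulVec (a k) (b k)).submatrix j.succAbove i.succAbove =
      ∑ k ∈ s, Matrix.vecMulVec (a k ∘ j.succAbove) (b k ∘ i.succAbove) := by
    ext
    simp [Matrix.sum_apply, Matrix.vecMulVec_apply]
  have hsign : (-1 : ℂ) ^ (n + (i : ℕ)) * (-1) ^ (n + (j : ℕ)) = (-1) ^ ((j : ℕ) + i) := by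
    rw [← pow_add, show n + (i : ℕ) + (n + j) = 2 * n + (j + i) by ring, pow_add, pow_mul,
      neg_one_sq, one_pow, one_mul]
  rw [Matrix.adjugate_fin_succ_eq_det_submatrix, hminor, cauchyBinet, Finset.mul_sum,
    Matrix.sum_apply, ← hsign]
  refine Finset.sum_congr rfl fun f _ => ?_
  rw [mul_comm (Matrix.det _), mul_mul_mul_comm]
  simp only [Matrix.vecMulVec_apply, wedge_eq_det_submatrix]
  rfl

end Wedge

/-! ### Partial derivatives -/

section PartialDerivatives

variable {g : ℕ} {i j : Fin g} {f h : (Fin g → ℂ) → ℂ} {z : Fin g → ℂ}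

theorem partialZ_mul (hf : LineDifferentiableAt ℂ f z (Pi.single i 1))
    (hh : LineDifferentiableAt ℂ h z (Pi.single i 1)) :
    partialZ i (fun x => f x * h x) z = partialZ i f z * h z + f z * partialZ i h z := by
  have hmul := HasDerivAt.fun_mul hf.hasLineDerivAt hh.hasLineDerivAt
  simp only [zero_smul, add_zero] at hmul
  exact hmul.deriv

theorem partialZ_sum_const_mul {κ : Type*} (s : Finset κ) (k : κ → ℂ)
    {F : κ → (Fin g → ℂ) → ℂ} (hF : ∀ ρ ∈ s, LineDifferentiableAt ℂ (F ρ) z (Pi.single i 1)) :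
    partialZ i (fun x => ∑ ρ ∈ s, k ρ * F ρ x) z = ∑ ρ ∈ s, k ρ * partialZ i (F ρ) z :=
  HasDerivAt.deriv (HasDerivAt.fun_sum fun ρ hρ =>
    HasDerivAt.const_mul (k ρ) (hF ρ hρ).hasLineDerivAt)

theorem partialZ_partialZ_mul_self_of_eq_zero
    (hi : LineDifferentiableAt ℂ f z (Pi.single i 1))
    (hj : ∀ x, LineDifferentiableAt ℂ f x (Pi.single j 1))
    (hij : LineDifferentiableAt ℂ (partialZ j f) z (Pi.single i 1)) (hz : f z = 0) :
    partialZ i (partialZ j fun x => f x * f x) z = 2 * (partialZ i f z * partialZ j f z) := by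
  have hsq : (partialZ j fun x => f x * f x) = fun x => f x * (2 * partialZ j f x) := by
    funext x
    rw [partialZ_mul (hj x) (hj x)]
    ring
  have hij' : LineDifferentiableAt ℂ (fun x => 2 * partialZ j f x) z (Pi.single i 1) :=
    DifferentiableAt.const_mul hij 2
  rw [hsq, partialZ_mul hi hij', hz]
  ring

end PartialDerivatives

/-! ### Exponential series -/

section ExponentialSeries

variable {ι κ : Type*} [Fintype κ]

/-- The exponential series `∑ c_p exp (u_p · z)` with frequencies `u` and coefficients `c`; the
theta functions are of this form. -/
def expSeries (u : ι → κ → ℂ) (c : ι → ℂ) (z : κ → ℂ) : ℂ :=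
  ∑' p, c p * Complex.exp (u p ⬝ᵥ z)

/-- Decay of the coefficients `c_p` faster than every exponential in the frequencies `u_p`: it makes
`expSeries u c` converge and allows it to be differentiated term by term. -/
def RapidDecay (u : ι → κ → ℂ) (c : ι → ℂ) : Prop :=
  ∀ R : ℝ, Summable fun p => ‖c p‖ * Real.exp (R * ‖u p‖)

theorem norm_dotProduct_le {R : Type*} [NonUnitalSeminormedRing R] (a b : κ → R) :
    ‖a ⬝ᵥ b‖ ≤ Fintype.card κ * ‖b‖ * ‖a‖ :=
  calc ‖a ⬝ᵥ b‖ ≤ ∑ i, ‖a i * b i‖ := norm_sum_le _ _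
    _ ≤ ∑ _i : κ, ‖b‖ * ‖a‖ := by
        gcongr with i
        rw [mul_comm ‖b‖]
        exact (norm_mul_le _ _).trans (by gcongr <;> exact norm_le_pi_norm _ i)
    _ = Fintype.card κ * ‖b‖ * ‖a‖ := by simp [mul_assoc]

theorem norm_exp_dotProduct_le (a b : κ → ℂ) :
    ‖Complex.exp (a ⬝ᵥ b)‖ ≤ Real.exp (Fintype.card κ * ‖b‖ * ‖a‖) := by
  rw [Complex.norm_exp]
  exact Real.exp_le_exp.2 ((Complex.re_le_norm _).trans (norm_dotProduct_le a b))

namespace RapidDecay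

variable {u : ι → κ → ℂ} {c : ι → ℂ}

theorem summable_norm (h : RapidDecay u c) (z : κ → ℂ) :
    Summable fun p => ‖c p * Complex.exp (u p ⬝ᵥ z)‖ := by
  refine Summable.of_nonneg_of_le (fun _ => norm_nonneg _) (fun p => ?_)
    (h (Fintype.card κ * ‖z‖))
  rw [norm_mul]
  exact mul_le_mul_of_nonneg_left (norm_exp_dotProduct_le _ _) (norm_nonneg _)

theorem mul_dotProduct (h : RapidDecay u c) (w : κ → ℂ) :
    RapidDecay u fun p => c p * (u p ⬝ᵥ w) := by
  intro R
  refine Summable.of_nonneg_of_le (fun _ => by positivity) (fun p => ?_)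
    (h (Fintype.card κ * ‖w‖ + R))
  rw [norm_mul, add_mul, Real.exp_add, mul_assoc]
  gcongr
  exact (norm_dotProduct_le _ _).trans
    (by linarith [Real.add_one_le_exp (Fintype.card κ * ‖w‖ * ‖u p‖)])

theorem smul (h : RapidDecay u c) (k : ℂ) : RapidDecay (fun p => k • u p) c := by
  intro R
  simpa [norm_smul, mul_assoc] using h (R * ‖k‖)

theorem hasLineDerivAt (h : RapidDecay u c) (z w : κ → ℂ) :
    HasLineDerivAt ℂ (expSeries u c) (expSeries u (fun p => c p * (u p ⬝ᵥ w)) z) z w := by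
  have hterm (p : ι) (t : ℂ) :
      HasDerivAt (fun t : ℂ => c p * Complex.exp (u p ⬝ᵥ (z + t • w)))
        (c p * (u p ⬝ᵥ w) * Complex.exp (u p ⬝ᵥ (z + t • w))) t := by
    have hexponent : HasDerivAt (fun t : ℂ => u p ⬝ᵥ (z + t • w)) (u p ⬝ᵥ w) t := by
      simp only [dotProduct_add, dotProduct_smul, smul_eq_mul]
      simpa using ((hasDerivAt_id t).mul_const (u p ⬝ᵥ w)).const_add (u p ⬝ᵥ z)
    exact (hexponent.cexp.const_mul (c p)).congr_deriv (by ring)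
  have hbound (p : ι) (t : ℂ) (ht : t ∈ Metric.ball 0 1) :
      ‖c p * (u p ⬝ᵥ w) * Complex.exp (u p ⬝ᵥ (z + t • w))‖ ≤
        ‖c p * (u p ⬝ᵥ w)‖ * Real.exp (Fintype.card κ * (‖z‖ + ‖w‖) * ‖u p‖) := by
    have hzt : ‖z + t • w‖ ≤ ‖z‖ + ‖w‖ := by
      refine (norm_add_le _ _).trans ?_
      rw [norm_smul]
      gcongr
      exact mul_le_of_le_one_left (norm_nonneg _) (mem_ball_zero_iff.1 ht).le
    rw [norm_mul]
    gcongr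
    exact (norm_exp_dotProduct_le _ _).trans (by gcongr)
  have hderiv := hasDerivAt_tsum_of_isPreconnected
    (h.mul_dotProduct w (Fintype.card κ * (‖z‖ + ‖w‖))) Metric.isOpen_ball
    (convex_ball (0 : ℂ) 1).isPreconnected (fun p t _ => hterm p t) hbound
    (Metric.mem_ball_self one_pos) (by simpa using (h.summable_norm z).of_norm)
    (Metric.mem_ball_self one_pos)
  simpa [HasLineDerivAt, expSeries] using hderiv

theorem lineDifferentiableAt (h : RapidDecay u c) (z w : κ → ℂ) :
    LineDifferentiableAt ℂ (expSeries u c) z w :=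
  (h.hasLineDerivAt z w).lineDifferentiableAt

theorem partialZ_eq {g : ℕ} {u : ι → Fin g → ℂ} (h : RapidDecay u c) (i : Fin g) :
    partialZ i (expSeries u c) = expSeries u fun p => c p * (u p ⬝ᵥ Pi.single i 1) :=
  funext fun z => (h.hasLineDerivAt z _).lineDeriv

theorem lineDifferentiableAt_partialZ {g : ℕ} {u : ι → Fin g → ℂ} (h : RapidDecay u c)
    (i : Fin g) (z w : Fin g → ℂ) :
    LineDifferentiableAt ℂ (partialZ i (expSeries u c)) z w := by
  rw [h.partialZ_eq]
  exact (h.mul_dotProduct _).lineDifferentiableAt z w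

end RapidDecay

end ExponentialSeries

/-! ### Gaussian sums over a lattice -/

section GaussianSums

variable {ι : Type*} [Fintype ι]

theorem summable_prod_apply {κ : ι → Type*} {f : ∀ i, κ i → ℝ} (hf : ∀ i, Summable (f i))
    (h0 : ∀ i, 0 ≤ f i) : Summable fun p : ∀ i, κ i => ∏ i, f i (p i) := by
  classical
  refine summable_of_sum_le (c := ∏ i, ∑' k, f i k) (fun p => Finset.prod_nonneg fun i _ => h0 i _)
    fun s => ?_
  calc ∑ p ∈ s, ∏ i, f i (p i)
      ≤ ∑ p ∈ Fintype.piFinset fun i => s.image fun p => p i, ∏ i, f i (p i) :=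
        Finset.sum_le_sum_of_subset_of_nonneg
          (fun p hp => Fintype.mem_piFinset.2 fun i => Finset.mem_image_of_mem (fun p => p i) hp)
          fun p _ _ => Finset.prod_nonneg fun i _ => h0 i _
    _ = ∏ i, ∑ k ∈ s.image fun p => p i, f i k := (Finset.prod_univ_sum _ _).symm
    _ ≤ ∏ i, ∑' k, f i k :=
        Finset.prod_le_prod (fun i _ => Finset.sum_nonneg fun k _ => h0 i k)
          fun i _ => (hf i).sum_le_tsum _ fun k _ => h0 i k

theorem summable_exp_neg_abs_int : Summable fun n : ℤ => Real.exp (-|(n : ℝ)|) := by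
  rw [summable_int_iff_summable_nat_and_neg]
  constructor <;> simpa using Real.summable_exp_neg_nat

theorem summable_exp_neg_card_mul_norm_int :
    Summable fun p : ι → ℤ => Real.exp (-(Fintype.card ι * ‖p‖)) := by
  refine Summable.of_nonneg_of_le (fun _ => (Real.exp_pos _).le) (fun p => ?_)
    (summable_prod_apply (fun _ => summable_exp_neg_abs_int) fun _ _ => (Real.exp_pos _).le)
  rw [← Real.exp_sum, Real.exp_le_exp, Finset.sum_neg_distrib, neg_le_neg_iff]
  calc ∑ i, |(p i : ℝ)| ≤ ∑ _i : ι, ‖p‖ := Finset.sum_le_sum fun i _ => norm_le_pi_norm p i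
    _ = Fintype.card ι * ‖p‖ := by simp

theorem sq_norm_le_dotProduct_self (x : ι → ℝ) : ‖x‖ ^ 2 ≤ x ⬝ᵥ x := by
  have hnonneg : 0 ≤ x ⬝ᵥ x := Finset.sum_nonneg fun i _ => mul_self_nonneg (x i)
  rw [← Real.le_sqrt (norm_nonneg x) hnonneg, pi_norm_le_iff_of_nonneg (Real.sqrt_nonneg _)]
  refine fun i => Real.abs_le_sqrt ?_
  rw [sq]
  exact Finset.single_le_sum (f := fun i => x i * x i) (fun i _ => mul_self_nonneg _)
    (Finset.mem_univ i)

open scoped MatrixOrder in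
theorem exists_pos_mul_sq_norm_le {Y : Matrix ι ι ℝ} (hY : Y.PosDef) :
    ∃ c > 0, ∀ x : ι → ℝ, c * ‖x‖ ^ 2 ≤ x ⬝ᵥ (Y *ᵥ x) := by
  classical
  obtain ⟨B, hB, rfl⟩ :=
    CStarAlgebra.isStrictlyPositive_iff_eq_star_mul_self.mp hY.isStrictlyPositive
  obtain ⟨K, hK, hanti⟩ := (Matrix.mulVecLin B).exists_antilipschitzWith
    (LinearMap.ker_eq_bot.2 (Matrix.mulVec_injective_of_isUnit hB))
  refine ⟨((K : ℝ) ^ 2)⁻¹, by positivity, fun x => ?_⟩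
  have hx : ‖x‖ ≤ K * ‖B *ᵥ x‖ := by simpa using hanti.le_mul_dist x 0
  rw [inv_mul_le_iff₀ (by positivity)]
  calc ‖x‖ ^ 2 ≤ (K * ‖B *ᵥ x‖) ^ 2 := by gcongr
    _ ≤ K ^ 2 * (B *ᵥ x ⬝ᵥ B *ᵥ x) := by
        rw [mul_pow]
        gcongr
        exact sq_norm_le_dotProduct_self _
    _ = K ^ 2 * (x ⬝ᵥ ((star B * B) *ᵥ x)) := by
        rw [Matrix.star_eq_conjTranspose, Matrix.conjTranspose_eq_transpose_of_trivial,
          ← Matrix.mulVec_mulVec, Matrix.dotProduct_mulVec x, Matrix.vecMul_transpose]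

theorem summable_exp_neg_posDef {Y : Matrix ι ι ℝ} (hY : Y.PosDef) (h : ι → ℝ) (R : ℝ) :
    Summable fun p : ι → ℤ =>
      let x : ι → ℝ := (fun i => (p i : ℝ)) + h
      Real.exp (-(Real.pi * x ⬝ᵥ (Y *ᵥ x))) * Real.exp (R * ‖x‖) := by
  obtain ⟨c, hc, hcY⟩ := exists_pos_mul_sq_norm_le hY
  set N : ℝ := (Fintype.card ι : ℝ)
  refine Summable.of_nonneg_of_le (fun _ => by positivity) (fun p => ?_)
    (summable_exp_neg_card_mul_norm_int.mul_left
      (Real.exp ((R + N) ^ 2 / (4 * (Real.pi * c)) + N * ‖h‖)))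
  dsimp only
  set x : ι → ℝ := (fun i => (p i : ℝ)) + h
  have hnorm : N * ‖p‖ ≤ N * (‖x‖ + ‖h‖) := by
    have hp : ‖p‖ = ‖x - h‖ := by simp only [x, add_sub_cancel_right]; rfl
    rw [hp]
    gcongr
    exact norm_sub_le _ _
  have hsquare : (R + N) * ‖x‖ - Real.pi * c * ‖x‖ ^ 2 ≤ (R + N) ^ 2 / (4 * (Real.pi * c)) := by
    rw [le_div_iff₀ (by positivity)]
    nlinarith [sq_nonneg (2 * (Real.pi * c) * ‖x‖ - (R + N))]
  have hquad : Real.pi * c * ‖x‖ ^ 2 ≤ Real.pi * x ⬝ᵥ (Y *ᵥ x) := by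
    rw [mul_assoc]
    exact mul_le_mul_of_nonneg_left (hcY x) Real.pi_pos.le
  rw [← Real.exp_add, ← Real.exp_add, Real.exp_le_exp]
  linarith

end GaussianSums

/-! ### Characters of `𝔽₂^g` -/

theorem sign2_eq_stdAddChar (x : ZMod 2) : sign2 x = ZMod.stdAddChar x := by
  obtain rfl | hx := eq_or_ne x 0
  · simp [sign2]
  · obtain rfl : x = 1 := Fin.eq_one_of_ne_zero x hx
    have h := ZMod.stdAddChar_coe (N := 2) 1
    rw [Int.cast_one, Int.cast_one, mul_one, Nat.cast_ofNat,
      show 2 * (Real.pi : ℂ) * Complex.I / 2 = Real.pi * Complex.I by ring,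
      Complex.exp_pi_mul_I] at h
    simp [h, sign2, ZMod.val_one]

theorem sign2_zero : sign2 0 = 1 := by simp [sign2]

theorem sign2_one : sign2 1 = -1 := by simp [sign2, ZMod.val_one]

theorem sign2_add (x y : ZMod 2) : sign2 (x + y) = sign2 x * sign2 y := by
  simp only [sign2_eq_stdAddChar, AddChar.map_add_eq_mul]

theorem sign2_sum {ι : Type*} (s : Finset ι) (f : ι → ZMod 2) :
    sign2 (∑ i ∈ s, f i) = ∏ i ∈ s, sign2 (f i) := by
  classical
  induction s using Finset.induction_on with
  | empty => simp [sign2_zero]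
  | insert i s hi ih => rw [Finset.sum_insert hi, Finset.prod_insert hi, sign2_add, ih]

theorem exp_pi_mul_I_mul_intCast (k : ℤ) :
    Complex.exp (Real.pi * Complex.I * k) = sign2 (k : ZMod 2) := by
  rw [sign2_eq_stdAddChar, ZMod.stdAddChar_coe]
  congr 1
  push_cast
  ring

theorem ite_eq_one_eq_one_sub_sign2 (x : ZMod 2) :
    (if x = 1 then 1 else 0 : ℂ) = (1 - sign2 x) / 2 := by
  obtain rfl | hx := eq_or_ne x 0
  · simp [sign2_zero]
  · obtain rfl : x = 1 := Fin.eq_one_of_ne_zero x hx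
    rw [if_pos rfl, sign2_one]
    norm_num

section FourierInversion

variable {ι : Type*} [Fintype ι]

theorem sum_sign2_dotProduct [DecidableEq ι] (β : ι → ZMod 2) :
    ∑ α : ι → ZMod 2, sign2 (β ⬝ᵥ α) = if β = 0 then 2 ^ Fintype.card ι else 0 := by
  split_ifs with hβ
  · simp [hβ, sign2_zero, ZMod.card]
  · obtain ⟨i, hi⟩ := Function.ne_iff.1 hβ
    have hshift := Equiv.sum_comp (Equiv.addRight (Pi.single i 1 : ι → ZMod 2))
      fun α => sign2 (β ⬝ᵥ α)
    simp only [Equiv.coe_addRight, dotProduct_add, dotProduct_single,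
      show β i = 1 from Fin.eq_one_of_ne_zero _ hi, mul_one, sign2_add, sign2_one, mul_neg,
      Finset.sum_neg_distrib] at hshift
    exact self_eq_neg.1 hshift.symm

theorem sum_sign2_dotProduct_of_dotProduct_eq_one [DecidableEq ι] (η β : ι → ZMod 2) :
    ∑ α with η ⬝ᵥ α = 1, sign2 (β ⬝ᵥ α) =
      2 ^ Fintype.card ι / 2 * ((if β = 0 then 1 else 0) - if β = η then 1 else 0) := by
  have hindicator (α : ι → ZMod 2) : (if η ⬝ᵥ α = 1 then sign2 (β ⬝ᵥ α) else 0) =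
      (sign2 (β ⬝ᵥ α) - sign2 ((β - η) ⬝ᵥ α)) / 2 := by
    rw [ZModModule.sub_eq_add β η, add_dotProduct, sign2_add, ← mul_one_sub, mul_div_assoc,
      ← ite_eq_one_eq_one_sub_sign2, mul_ite, mul_one, mul_zero]
  simp only [Finset.sum_filter, hindicator, ← Finset.sum_div, Finset.sum_sub_distrib,
    sum_sign2_dotProduct, sub_eq_zero]
  split_ifs <;> ring

theorem sum_sign2_mul_sum_sign2_mul [DecidableEq ι] (η δ : ι → ZMod 2)
    (a : (ι → ZMod 2) → ℂ) :
    ∑ α with η ⬝ᵥ α = 1, sign2 (δ ⬝ᵥ α) * ∑ ρ, sign2 (ρ ⬝ᵥ α) * a ρ =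
      2 ^ Fintype.card ι / 2 * (a δ - a (η + δ)) := by
  calc ∑ α with η ⬝ᵥ α = 1, sign2 (δ ⬝ᵥ α) * ∑ ρ, sign2 (ρ ⬝ᵥ α) * a ρ
      = ∑ ρ, (∑ α with η ⬝ᵥ α = 1, sign2 ((ρ - δ) ⬝ᵥ α)) * a ρ := by
        simp only [ZModModule.sub_eq_add, add_dotProduct, sign2_add, Finset.mul_sum,
          Finset.sum_mul]
        rw [Finset.sum_comm]
        exact Finset.sum_congr rfl fun ρ _ => Finset.sum_congr rfl fun α _ => by ring
    _ = ∑ ρ, 2 ^ Fintype.card ι / 2 *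
          ((if ρ = δ then a ρ else 0) - if ρ = η + δ then a ρ else 0) := by
        refine Finset.sum_congr rfl fun ρ _ => ?_
        rw [sum_sign2_dotProduct_of_dotProduct_eq_one]
        simp only [sub_eq_iff_eq_add, zero_add, mul_assoc, sub_mul, ite_mul, one_mul, zero_mul]
    _ = 2 ^ Fintype.card ι / 2 * (a δ - a (η + δ)) := by
        rw [← Finset.mul_sum, Finset.sum_sub_distrib]
        simp only [Finset.sum_ite_eq', Finset.mem_univ, if_true]

end FourierInversion

/-! ### Theta functions as exponential series -/

section ThetaSeries

variable {g : ℕ}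

/-- The point `p + ε / 2` of the translate by `ε / 2` of the lattice `ℤ^g`: these points are the
frequencies of the theta functions with characteristic `[ε, δ]`, up to the factor `2πi`. -/
def shift (ε : F2 g) (p : Fin g → ℤ) : Fin g → ℂ := (fun i => (p i : ℂ)) + half ε

/-- The summand of index `p` of the series `theta m τ z`. -/
def thetaTerm (m : Characteristic g) (τ : Matrix (Fin g) (Fin g) ℂ) (z : Fin g → ℂ)
    (p : Fin g → ℤ) : ℂ :=
  Complex.exp (Real.pi * Complex.I *
    (shift m.1 p ⬝ᵥ (τ *ᵥ shift m.1 p) + 2 * (shift m.1 p ⬝ᵥ (z + half m.2))))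

theorem theta_eq_tsum (m : Characteristic g) (τ : Matrix (Fin g) (Fin g) ℂ) (z : Fin g → ℂ) :
    theta m τ z = ∑' p, thetaTerm m τ z p :=
  rfl

theorem half_zero : half (0 : F2 g) = 0 := by
  ext
  simp [half]

theorem half_eq_ofReal_comp (ε : F2 g) :
    half ε = Complex.ofReal ∘ fun i => ((ε i).val : ℝ) / 2 := by
  ext
  simp only [half, Function.comp_apply]
  push_cast
  rfl

theorem shift_eq_ofReal_comp (ε : F2 g) (p : Fin g → ℤ) :
    shift ε p = Complex.ofReal ∘ ((fun i => (p i : ℝ)) + fun i => ((ε i).val : ℝ) / 2) := by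
  ext
  simp only [shift, half_eq_ofReal_comp, Pi.add_apply, Function.comp_apply]
  push_cast
  rfl

theorem thetaTerm_eq_mul_exp (m : Characteristic g) (τ : Matrix (Fin g) (Fin g) ℂ)
    (z : Fin g → ℂ) (p : Fin g → ℤ) :
    thetaTerm m τ z p =
      thetaTerm m τ 0 p * Complex.exp ((2 * Real.pi * Complex.I) • shift m.1 p ⬝ᵥ z) := by
  simp only [thetaTerm, ← Complex.exp_add, smul_dotProduct, smul_eq_mul, dotProduct_add,
    dotProduct_zero]
  ring_nf

theorem theta_eq_expSeries (m : Characteristic g) (τ : Matrix (Fin g) (Fin g) ℂ) :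
    theta m τ =
      expSeries (fun p => (2 * Real.pi * Complex.I) • shift m.1 p) (thetaTerm m τ 0) :=
  funext fun z => tsum_congr fun p => thetaTerm_eq_mul_exp m τ z p

theorem theta2_eq_expSeries (σ : F2 g) (τ : Matrix (Fin g) (Fin g) ℂ) :
    theta2 σ τ = expSeries (fun p => (2 : ℂ) • (2 * Real.pi * Complex.I) • shift σ p)
      (thetaTerm (σ, 0) ((2 : ℂ) • τ) 0) := by
  funext z
  rw [theta2, theta_eq_expSeries]
  simp only [expSeries, dotProduct_smul, smul_dotProduct]

theorem im_dotProduct_mulVec_ofReal_comp {ι : Type*} [Fintype ι] (τ : Matrix ι ι ℂ)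
    (x y : ι → ℝ) :
    (Complex.ofReal ∘ x ⬝ᵥ (τ *ᵥ (Complex.ofReal ∘ y))).im = x ⬝ᵥ (τ.map Complex.im *ᵥ y) := by
  simp only [dotProduct, Matrix.mulVec, Complex.im_sum, Function.comp_apply,
    Complex.im_ofReal_mul, Complex.im_mul_ofReal, Matrix.map_apply]

theorem norm_thetaTerm_zero (m : Characteristic g) (τ : Matrix (Fin g) (Fin g) ℂ)
    (p : Fin g → ℤ) :
    let x : Fin g → ℝ := (fun i => (p i : ℝ)) + fun i => ((m.1 i).val : ℝ) / 2
    ‖thetaTerm m τ 0 p‖ = Real.exp (-(Real.pi * x ⬝ᵥ (τ.map Complex.im *ᵥ x))) := by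
  intro x
  have hreal : (shift m.1 p ⬝ᵥ half m.2).im = 0 := by
    rw [shift_eq_ofReal_comp, half_eq_ofReal_comp]
    exact congrArg Complex.im (Complex.ofRealHom.map_dotProduct _ _).symm
  rw [thetaTerm, Complex.norm_exp, mul_assoc, Complex.re_ofReal_mul, Complex.I_mul_re, mul_neg,
    Complex.add_im, zero_add, ← Complex.ofReal_ofNat, Complex.im_ofReal_mul, hreal, mul_zero,
    add_zero, shift_eq_ofReal_comp, im_dotProduct_mulVec_ofReal_comp]

theorem rapidDecay_theta (m : Characteristic g) {τ : Matrix (Fin g) (Fin g) ℂ}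
    (hτ : (τ.map Complex.im).PosDef) :
    RapidDecay (fun p => (2 * Real.pi * Complex.I) • shift m.1 p) (thetaTerm m τ 0) := by
  intro R
  refine (summable_exp_neg_posDef hτ (fun i => ((m.1 i).val : ℝ) / 2) (R * (2 * Real.pi))).congr
    fun p => ?_
  have hnorm (x : Fin g → ℝ) : ‖Complex.ofReal ∘ x‖ = ‖x‖ := by simp [Pi.norm_def]
  rw [norm_thetaTerm_zero, norm_smul, shift_eq_ofReal_comp, hnorm]
  simp [mul_assoc, abs_of_pos Real.pi_pos]

theorem posDef_map_im_two_smul {ι : Type*} {τ : Matrix ι ι ℂ}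
    (hτ : (τ.map Complex.im).PosDef) : (((2 : ℂ) • τ).map Complex.im).PosDef := by
  have him : ((2 : ℂ) • τ).map Complex.im = (2 : ℝ) • τ.map Complex.im := by
    ext
    simp
  rw [him]
  exact hτ.smul two_pos

theorem rapidDecay_theta2 (σ : F2 g) {τ : Matrix (Fin g) (Fin g) ℂ}
    (hτ : (τ.map Complex.im).PosDef) :
    RapidDecay (fun p => (2 : ℂ) • (2 * Real.pi * Complex.I) • shift σ p)
      (thetaTerm (σ, 0) ((2 : ℂ) • τ) 0) :=
  (rapidDecay_theta (σ, 0) (posDef_map_im_two_smul hτ)).smul 2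

theorem lineDifferentiableAt_theta (m : Characteristic g) {τ : Matrix (Fin g) (Fin g) ℂ}
    (hτ : (τ.map Complex.im).PosDef) (z w : Fin g → ℂ) :
    LineDifferentiableAt ℂ (theta m τ) z w := by
  rw [theta_eq_expSeries]
  exact (rapidDecay_theta m hτ).lineDifferentiableAt z w

theorem lineDifferentiableAt_partialZ_theta (m : Characteristic g)
    {τ : Matrix (Fin g) (Fin g) ℂ} (hτ : (τ.map Complex.im).PosDef) (i : Fin g)
    (z w : Fin g → ℂ) : LineDifferentiableAt ℂ (partialZ i (theta m τ)) z w := by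
  rw [theta_eq_expSeries]
  exact (rapidDecay_theta m hτ).lineDifferentiableAt_partialZ i z w

theorem lineDifferentiableAt_theta2 (σ : F2 g) {τ : Matrix (Fin g) (Fin g) ℂ}
    (hτ : (τ.map Complex.im).PosDef) (z w : Fin g → ℂ) :
    LineDifferentiableAt ℂ (theta2 σ τ) z w := by
  rw [theta2_eq_expSeries]
  exact (rapidDecay_theta2 σ hτ).lineDifferentiableAt z w

theorem lineDifferentiableAt_partialZ_theta2 (σ : F2 g) {τ : Matrix (Fin g) (Fin g) ℂ}
    (hτ : (τ.map Complex.im).PosDef) (i : Fin g) (z w : Fin g → ℂ) :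
    LineDifferentiableAt ℂ (partialZ i (theta2 σ τ)) z w := by
  rw [theta2_eq_expSeries]
  exact (rapidDecay_theta2 σ hτ).lineDifferentiableAt_partialZ i z w

theorem summable_norm_thetaTerm (m : Characteristic g) {τ : Matrix (Fin g) (Fin g) ℂ}
    (hτ : (τ.map Complex.im).PosDef) (z : Fin g → ℂ) :
    Summable fun p => ‖thetaTerm m τ z p‖ := by
  simp only [thetaTerm_eq_mul_exp m τ z]
  exact (rapidDecay_theta m hτ).summable_norm z

end ThetaSeries

/-! ### The addition formula -/

section AdditionFormula

variable {g : ℕ}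

theorem exp_shift_dotProduct_half (ρ α : F2 g) (k : Fin g → ℤ) :
    Complex.exp (Real.pi * Complex.I * (4 * (shift ρ k ⬝ᵥ half α))) = sign2 (ρ ⬝ᵥ α) := by
  have hinteger : 4 * (shift ρ k ⬝ᵥ half α) =
      ((∑ i, (2 * k i + (ρ i).val) * ((α i).val : ℤ) : ℤ) : ℂ) := by
    simp only [dotProduct, Finset.mul_sum, shift, half, Pi.add_apply]
    push_cast
    exact Finset.sum_congr rfl fun i _ => by ring
  rw [hinteger, exp_pi_mul_I_mul_intCast]
  congr 1
  push_cast
  refine Finset.sum_congr rfl fun i _ => ?_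
  rw [ZMod.natCast_zmod_val, ZMod.natCast_zmod_val, show (2 : ZMod 2) = 0 from rfl, zero_mul,
    zero_add]

theorem natCast_val_add (r e : ZMod 2) :
    ((r + e).val : ℤ) = r.val + e.val - 2 * (r.val * e.val) := by
  revert r e
  decide

/-- The bijection `pairIndex` below in one coordinate, with `e` and `r` the coordinates of `η` and
`ρ`. The sum `r + e` in `𝔽₂` lifts to the integer `r + e - 2re`, so no division is needed in the
forward direction. -/
def pairIndexCoord (e : ZMod 2) : ZMod 2 × ℤ × ℤ ≃ ℤ × ℤ where
  toFun y := (y.2.1 + y.2.2 + y.1.val * (1 - e.val), y.2.1 - y.2.2 - e.val * (1 - y.1.val))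
  invFun x := ((x.1 + x.2 + e.val : ℤ), (x.1 + x.2 + e.val) / 2, (x.1 - x.2) / 2)
  left_inv := by
    rintro ⟨r, k, l⟩
    have hsum : k + l + (r.val : ℤ) * (1 - e.val) + (k - l - e.val * (1 - r.val)) + e.val =
      2 * k + r.val := by ring
    have hsub : k + l + (r.val : ℤ) * (1 - e.val) - (k - l - e.val * (1 - r.val)) =
      2 * l + (r + e).val := by rw [natCast_val_add]; ring
    have hr := r.val_lt
    have hre := (r + e).val_lt
    simp only [hsum, hsub, Prod.mk.injEq]
    refine ⟨?_, by omega, by omega⟩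
    push_cast
    rw [ZMod.natCast_zmod_val, show (2 : ZMod 2) = 0 from rfl, zero_mul, zero_add]
  right_inv := by
    rintro ⟨p, q⟩
    have hval := ZMod.val_intCast (n := 2) (p + q + e.val)
    have he := e.val_lt
    simp only [hval, Prod.mk.injEq]
    obtain he | he : e.val = 0 ∨ e.val = 1 := by omega
    all_goals
      rw [he]
      constructor <;> push_cast <;> omega

/-- The bijection `(ρ, k, l) ↦ (p, q)` for which `(p + η/2, q + η/2) = (a + b, a - b)`, where
`a = k + ρ/2` and `b = l + (ρ + η)/2`: it reindexes the product of two theta series in the addition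
formula. -/
def pairIndex (η : F2 g) :
    F2 g × (Fin g → ℤ) × (Fin g → ℤ) ≃ (Fin g → ℤ) × (Fin g → ℤ) :=
  ((Equiv.refl _).prodCongr (Equiv.arrowProdEquivProdArrow _ _ _).symm).trans <|
    (Equiv.arrowProdEquivProdArrow _ _ _).symm.trans <|
      (Equiv.piCongrRight fun i => pairIndexCoord (η i)).trans (Equiv.arrowProdEquivProdArrow _ _ _)

theorem shift_pairIndex_fst (η ρ : F2 g) (k l : Fin g → ℤ) :
    shift η (pairIndex η (ρ, k, l)).1 = shift ρ k + shift (ρ + η) l := by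
  ext i
  have hcoord : (pairIndex η (ρ, k, l)).1 i = k i + l i + (ρ i).val * (1 - (η i).val) := rfl
  have hval := congrArg (Int.cast (R := ℂ)) (natCast_val_add (ρ i) (η i))
  simp only [shift, half, Pi.add_apply, hcoord]
  push_cast at hval ⊢
  rw [hval]
  ring

theorem shift_pairIndex_snd (η ρ : F2 g) (k l : Fin g → ℤ) :
    shift η (pairIndex η (ρ, k, l)).2 = shift ρ k - shift (ρ + η) l := by
  ext i
  have hcoord : (pairIndex η (ρ, k, l)).2 i = k i - l i - (η i).val * (1 - (ρ i).val) := rfl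
  have hval := congrArg (Int.cast (R := ℂ)) (natCast_val_add (ρ i) (η i))
  simp only [shift, half, Pi.add_apply, Pi.sub_apply, hcoord]
  push_cast at hval ⊢
  rw [hval]
  ring

theorem thetaTerm_mul_thetaTerm (η α ρ : F2 g) (τ : Matrix (Fin g) (Fin g) ℂ)
    (x y : Fin g → ℂ) (k l : Fin g → ℤ) :
    thetaTerm (η, α) τ (x + y) (pairIndex η (ρ, k, l)).1 *
        thetaTerm (η, α) τ (x - y) (pairIndex η (ρ, k, l)).2 =
      sign2 (ρ ⬝ᵥ α) * (thetaTerm (ρ, 0) ((2 : ℂ) • τ) ((2 : ℂ) • x) k *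
        thetaTerm (ρ + η, 0) ((2 : ℂ) • τ) ((2 : ℂ) • y) l) := by
  rw [← exp_shift_dotProduct_half ρ α k]
  simp only [thetaTerm, shift_pairIndex_fst, shift_pairIndex_snd, half_zero, ← Complex.exp_add]
  generalize shift ρ k = a
  generalize shift (ρ + η) l = b
  simp only [Matrix.mulVec_add, Matrix.mulVec_sub, Matrix.smul_mulVec, add_dotProduct,
    sub_dotProduct, dotProduct_add, dotProduct_sub, dotProduct_smul, dotProduct_zero, smul_eq_mul]
  ring_nf

theorem theta_add_mul_theta_sub (η α : F2 g) {τ : Matrix (Fin g) (Fin g) ℂ}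
    (hτ : (τ.map Complex.im).PosDef) (x y : Fin g → ℂ) :
    theta (η, α) τ (x + y) * theta (η, α) τ (x - y) =
      ∑ ρ : F2 g, sign2 (ρ ⬝ᵥ α) * (theta2 ρ τ x * theta2 (ρ + η) τ y) := by
  have hτ2 := posDef_map_im_two_smul hτ
  have hadd := summable_norm_thetaTerm (η, α) hτ (x + y)
  have hsub := summable_norm_thetaTerm (η, α) hτ (x - y)
  simp only [theta2, theta_eq_tsum]
  calc (∑' p, thetaTerm (η, α) τ (x + y) p) * ∑' q, thetaTerm (η, α) τ (x - y) q
      = ∑' w, thetaTerm (η, α) τ (x + y) (pairIndex η w).1 *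
          thetaTerm (η, α) τ (x - y) (pairIndex η w).2 := by
        rw [tsum_mul_tsum_of_summable_norm hadd hsub, ← (pairIndex η).tsum_eq]
    _ = ∑ ρ, ∑' kl : (Fin g → ℤ) × (Fin g → ℤ),
          thetaTerm (η, α) τ (x + y) (pairIndex η (ρ, kl.1, kl.2)).1 *
            thetaTerm (η, α) τ (x - y) (pairIndex η (ρ, kl.1, kl.2)).2 := by
        rw [← tsum_fintype (L := .unconditional _)]
        exact ((summable_mul_of_summable_norm hadd hsub).comp_injective
          (pairIndex η).injective).tsum_prod
    _ = _ := by
        refine Finset.sum_congr rfl fun ρ _ => ?_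
        simp only [thetaTerm_mul_thetaTerm]
        rw [tsum_mul_left, tsum_mul_tsum_of_summable_norm (summable_norm_thetaTerm _ hτ2 _)
          (summable_norm_thetaTerm _ hτ2 _)]

end AdditionFormula

/-! ### Gradients of odd theta functions -/

section OddGradients

variable {g : ℕ}

theorem shift_reflect (ε : F2 g) (p : Fin g → ℤ) :
    shift ε ((fun i => -((ε i).val : ℤ)) - p) = -shift ε p := by
  ext i
  simp only [shift, half, Pi.add_apply, Pi.sub_apply, Pi.neg_apply]
  push_cast
  ring

theorem thetaTerm_neg_reflect (m : Characteristic g) (τ : Matrix (Fin g) (Fin g) ℂ)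
    (z : Fin g → ℂ) (p : Fin g → ℤ) :
    thetaTerm m τ (-z) ((fun i => -((m.1 i).val : ℤ)) - p) =
      sign2 (m.1 ⬝ᵥ m.2) * thetaTerm m τ z p := by
  rw [← exp_shift_dotProduct_half m.1 m.2 ((fun i => -((m.1 i).val : ℤ)) - p)]
  simp only [thetaTerm, shift_reflect, ← Complex.exp_add, Matrix.mulVec_neg, neg_dotProduct,
    dotProduct_neg, dotProduct_add]
  ring_nf

theorem theta_neg (m : Characteristic g) (τ : Matrix (Fin g) (Fin g) ℂ) (z : Fin g → ℂ) :
    theta m τ (-z) = sign2 (m.1 ⬝ᵥ m.2) * theta m τ z := by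
  rw [theta_eq_tsum, ← (Equiv.subLeft fun i => -((m.1 i).val : ℤ)).tsum_eq]
  simp only [Equiv.subLeft_apply, thetaTerm_neg_reflect, tsum_mul_left, theta_eq_tsum]

theorem theta_zero_of_isOdd {m : Characteristic g} (hm : m.IsOdd)
    (τ : Matrix (Fin g) (Fin g) ℂ) : theta m τ 0 = 0 := by
  have hneg := theta_neg m τ 0
  rw [neg_zero, show m.1 ⬝ᵥ m.2 = 1 from hm, sign2_one, neg_one_mul] at hneg
  exact self_eq_neg.1 hneg

theorem two_mul_thetaGrad_mul_thetaGrad {η α : F2 g} (hodd : Characteristic.IsOdd (η, α))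
    {τ : Matrix (Fin g) (Fin g) ℂ} (hτ : (τ.map Complex.im).PosDef) (i j : Fin g) :
    2 * (thetaGrad (η, α) τ i * thetaGrad (η, α) τ j) =
      ∑ ρ : F2 g, sign2 (ρ ⬝ᵥ α) *
        (partialZ i (partialZ j (theta2 ρ τ)) 0 * theta2 (ρ + η) τ 0) := by
  have hsquare : (fun x => theta (η, α) τ x * theta (η, α) τ x) =
      fun x => ∑ ρ : F2 g, sign2 (ρ ⬝ᵥ α) * theta2 (ρ + η) τ 0 * theta2 ρ τ x := by
    funext x
    have hadd := theta_add_mul_theta_sub η α hτ x 0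
    rw [add_zero, sub_zero] at hadd
    rw [hadd]
    exact Finset.sum_congr rfl fun ρ _ => by ring
  have hderiv : (partialZ j fun x => theta (η, α) τ x * theta (η, α) τ x) =
      fun x => ∑ ρ : F2 g, sign2 (ρ ⬝ᵥ α) * theta2 (ρ + η) τ 0 * partialZ j (theta2 ρ τ) x := by
    funext x
    rw [hsquare, partialZ_sum_const_mul _ _ fun ρ _ => lineDifferentiableAt_theta2 ρ hτ x _]
  calc 2 * (thetaGrad (η, α) τ i * thetaGrad (η, α) τ j)
      = partialZ i (partialZ j fun x => theta (η, α) τ x * theta (η, α) τ x) 0 :=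
        (partialZ_partialZ_mul_self_of_eq_zero (lineDifferentiableAt_theta _ hτ _ _)
          (fun x => lineDifferentiableAt_theta _ hτ x _)
          (lineDifferentiableAt_partialZ_theta _ hτ j _ _) (theta_zero_of_isOdd hodd τ)).symm
    _ = ∑ ρ : F2 g, sign2 (ρ ⬝ᵥ α) * theta2 (ρ + η) τ 0 *
          partialZ i (partialZ j (theta2 ρ τ)) 0 := by
        rw [hderiv, partialZ_sum_const_mul _ _
          fun ρ _ => lineDifferentiableAt_partialZ_theta2 ρ hτ j 0 _]
    _ = _ := Finset.sum_congr rfl fun ρ _ => by ring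

theorem matA_eq_sum_vecMulVec (ε δ : F2 g) {τ : Matrix (Fin g) (Fin g) ℂ}
    (hτ : (τ.map Complex.im).PosDef) :
    matA ε δ τ = ∑ α with Characteristic.IsOdd (ε + δ, α),
      Matrix.vecMulVec ((4 / 2 ^ g * sign2 (δ ⬝ᵥ α)) • thetaGrad (ε + δ, α) τ)
        (thetaGrad (ε + δ, α) τ) := by
  ext i j
  have hadd : ε + δ + δ = ε := by simp [add_assoc, ZModModule.add_self]
  have hδ : δ + (ε + δ) = ε := by rw [add_comm, hadd]
  have hε : ε + (ε + δ) = δ := by simp [← add_assoc, ZModModule.add_self]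
  have hinversion := sum_sign2_mul_sum_sign2_mul (ε + δ) δ fun ρ =>
    partialZ i (partialZ j (theta2 ρ τ)) 0 * theta2 (ρ + (ε + δ)) τ 0
  rw [hadd, hδ, hε, Fintype.card_fin] at hinversion
  simp only [Matrix.sum_apply, Matrix.vecMulVec_apply, Pi.smul_apply, smul_eq_mul]
  calc matA ε δ τ i j
      = 2 / 2 ^ g * (2 ^ g / 2 * matA ε δ τ i j) := by
        field_simp
    _ = _ := by
      rw [matA, Matrix.of_apply, ← hinversion, Finset.mul_sum]
      refine Finset.sum_congr rfl fun α hα => ?_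
      rw [← two_mul_thetaGrad_mul_thetaGrad (Finset.mem_filter.1 hα).2 hτ]
      ring

end OddGradients

/-! ### The adjugate of `matA` -/

-- The truncated subtraction in `n + 1 - 2` is harmless: for `n = 0` the base has exponent `0`.
theorem pi_sq_div_pow_mul_pi_zpow (n : ℕ) :
    ((Real.pi : ℂ) ^ 2 / 2 ^ (n + 1 - 2)) ^ n * (Real.pi : ℂ) ^ (-2 * ((n + 1 : ℕ) : ℤ) + 2) =
      (4 / 2 ^ (n + 1)) ^ n := by
  obtain _ | n := n
  · simp
  · have hpi : (Real.pi : ℂ) ≠ 0 := Complex.ofReal_ne_zero.2 Real.pi_ne_zero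
    rw [show -2 * ((n + 1 + 1 : ℕ) : ℤ) + 2 = -((2 * (n + 1) : ℕ) : ℤ) by push_cast; ring,
      zpow_neg, zpow_natCast, pow_mul, ← inv_pow, ← mul_pow,
      show n + 1 + 1 - 2 = n from rfl]
    congr 1
    field_simp
    ring

theorem vecMulVec_wedge_smul_thetaGrad {n : ℕ} (η δ : F2 (n + 1)) (α : Fin n → F2 (n + 1))
    (τ : Matrix (Fin (n + 1)) (Fin (n + 1)) ℂ) :
    Matrix.vecMulVec (wedge (g := n + 1) fun j : Fin n => thetaGrad (η, α j) τ)
        (wedge (g := n + 1) fun j : Fin n =>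
          (4 / 2 ^ (n + 1) * sign2 (δ ⬝ᵥ α j)) • thetaGrad (η, α j) τ) =
      ((Real.pi : ℂ) ^ 2 / 2 ^ (n + 1 - 2)) ^ n •
        sign2 (δ ⬝ᵥ ∑ j, α j) • formW (g := n + 1) (fun j : Fin n => (η, α j)) τ := by
  rw [wedge_smul, Finset.prod_mul_distrib, Finset.prod_const, Finset.card_univ, Fintype.card_fin,
    ← sign2_sum, ← dotProduct_sum, Matrix.vecMulVec_smul, ← pi_sq_div_pow_mul_pi_zpow, formW,
    smul_smul, smul_smul, mul_right_comm]
  rfl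

end ThetaGradients

end

theorem mainTheorem4_general {g : ℕ} (ε δ : ThetaGradients.F2 g) {κ : Type*} [LinearOrder κ]
    {key : ThetaGradients.F2 g → κ} (hkey : Function.Injective key)
    {τ : Matrix (Fin g) (Fin g) ℂ} (hτ : (τ.map Complex.im).PosDef) :
    (ThetaGradients.matA ε δ τ).adjugate =
      ((Real.pi : ℂ) ^ 2 / 2 ^ (g - 2)) ^ (g - 1) •
        ∑ α : Fin (g - 1) → ThetaGradients.F2 g with
            (∀ i j, i < j → key (α i) < key (α j)) ∧
              ∀ j, ThetaGradients.Characteristic.IsOdd (ε + δ, α j),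
          ThetaGradients.sign2 (δ ⬝ᵥ ∑ j, α j) •
            ThetaGradients.formW (fun j => (ε + δ, α j)) τ := by
  obtain _ | n := g
  · exact Subsingleton.elim _ _
  let _ : LinearOrder (ThetaGradients.F2 (n + 1)) := LinearOrder.lift' key hkey
  rw [ThetaGradients.matA_eq_sum_vecMulVec ε δ hτ, ThetaGradients.adjugate_sum_vecMulVec,
    Finset.smul_sum]
  refine Finset.sum_congr ?_ fun α _ =>
    ThetaGradients.vecMulVec_wedge_smul_thetaGrad (ε + δ) δ α τ
  ext α
  simp only [Finset.mem_filter, Fintype.mem_piFinset, Finset.mem_univ, true_and]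
  exact and_comm

/-- The sum runs over the sets `{α_1, …, α_{g-1}}` of distinct elements of `𝔽₂^g` with all
`[ε + δ, α_j]` odd; each set is listed once, increasingly for an arbitrary numbering `idx` of
`𝔽₂^g`. -/
theorem mainTheorem4 {g : ℕ} (hg : 2 ≤ g) (ε δ : ThetaGradients.F2 g) (hεδ : ε ≠ δ)
    (idx : ThetaGradients.F2 g ≃ Fin (2 ^ g))
    (τ : Matrix (Fin g) (Fin g) ℂ) (hτ : τ ∈ ThetaGradients.siegelUpperHalfSpace g) :
    (ThetaGradients.matA ε δ τ).adjugate =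
      ((Real.pi : ℂ) ^ 2 / 2 ^ (g - 2)) ^ (g - 1) •
        ∑ α : Fin (g - 1) → ThetaGradients.F2 g with
            (∀ i j, i < j → idx (α i) < idx (α j)) ∧
              ∀ j, ThetaGradients.Characteristic.IsOdd (ε + δ, α j),
          ThetaGradients.sign2 (δ ⬝ᵥ ∑ j, α j) •
            ThetaGradients.formW (fun j => (ε + δ, α j)) τ :=
  mainTheorem4_general ε δ idx.injective hτ.2
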